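/- Let $K$ be a field, $n\ge 0$ and $c\ge 1$ integers, $R=K[x_1,\dots,x_n]$, and let $<$ be the degree-lexicographic order on $R$ with $x_1>x_2>\cdots>x_n$. For $t\ge 1$ let $X_t$ be the $t\times (n-(t-1)c)$ matrix whose entry in row $i$ and column $j$ is $x_{j+(i-1)c}$ (with no columns if $n\le (t-1)c$), and let $I_t\subseteq R$ be the ideal generated by the $t$-minors of $X_t$ (so $I_t=0$ if $X_t$ has fewer than $t$ columns). (It is well known that $I_2$ is the defining ideal of the balanced rational normal scroll of dimension $c$ in $\mathbb{P}^{n-1}$, if $n\geq c+2$.) For an ideal $I\subseteq R$ let $\operatorname{in}(I)$ be the ideal generated by the leading terms, with respect to $<$, of the elements of $I$. For $r\ge 1$ the $r$-th secant ideal $I^{\{r\}}$ is the $r$-fold join of $I$ with itself, i.e. the elimination ideal $$\Big(I(y_1)+\cdots+I(y_r)+\big\langle y_{1i}+\cdots+y_{ri}-x_i : i=1,\dots,n\big\rangle\Big)\cap K[x_1,\dots,x_n],$$ where $y_j=(y_{j1},\dots,y_{jn})$, $j=1,\dots,r$, are vectors of new indeterminates and $I(y_j)$ denotes the ideal of $K[x,y]$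 generated by the image of $I$ under $x_i\mapsto y_{ji}$. Then the order $<$ is delightful for $I_2$, that is, $$\operatorname{in}\big(I_2^{\{r\}}\big)=\big(\operatorname{in}(I_2)\big)^{\{r\}}\qquad\text{for all } r\ge 1.$$ Moreover, for every $r\ge 1$, $I_2^{\{r\}}=I_{r+1}$, and the $(r+1)$-minors of $X_{r+1}$ form a Gröbner basis of $I_2^{\{r\}}$ with respect to $<$: they are finitely many nonzero elements of $I_2^{\{r\}}$ whose leading terms generate $\operatorname{in}(I_2^{\{r\}})$. -/

import Mathlib

open MvPolynomial

namespace ExtHankel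

noncomputable section

/-- The join `I₁ * ⋯ * I_r` of ideals of `K[x]`. In the polynomial ring in the variables
`x_i` (`Sum.inl i`) and `y_{ji}` (`Sum.inr (j, i)`), take the ideal
`I₁(y₁) + ⋯ + I_r(y_r) + ⟨y_{1i} + ⋯ + y_{ri} - x_i⟩` and intersect it with `K[x]`. -/
def joinIdeal {K σ : Type*} [Field K] {r : ℕ} (I : Fin r → Ideal (MvPolynomial σ K)) :
    Ideal (MvPolynomial σ K) :=
  Ideal.comap (rename Sum.inl : MvPolynomial σ K →ₐ[K] MvPolynomial (σ ⊕ Fin r × σ) K)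
    ((⨆ j : Fin r, Ideal.map
        (rename (fun i : σ => Sum.inr (j, i)) :
          MvPolynomial σ K →ₐ[K] MvPolynomial (σ ⊕ Fin r × σ) K) (I j)) ⊔
      Ideal.span (Set.range fun i : σ =>
        (∑ j : Fin r, X (Sum.inr (j, i)) - X (Sum.inl i) : MvPolynomial (σ ⊕ Fin r × σ) K)))

/-- The `r`-th secant ideal `I^{\{r\}}` (for `r ≥ 1`): the `r`-fold join of `I` with itself. -/
def secantIdeal {K σ : Type*} [Field K] (r : ℕ) (I : Ideal (MvPolynomial σ K)) :
    Ideal (MvPolynomial σ K) :=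
  joinIdeal (fun _ : Fin r => I)

/-- The initial ideal `in(I)`, generated by the leading terms of the elements of `I`. -/
def initialIdeal {K σ : Type*} [Field K] (ord : MonomialOrder σ)
    (I : Ideal (MvPolynomial σ K)) : Ideal (MvPolynomial σ K) :=
  Ideal.span (ord.leadingTerm '' (I : Set (MvPolynomial σ K)))

/-- The term order `ord` is delightful for `I`: passing to the initial ideal commutes with
taking the `r`-th secant ideal for every `r ≥ 1`. -/
def IsDelightful {K σ : Type*} [Field K] (ord : MonomialOrder σ)
    (I : Ideal (MvPolynomial σ K)) : Prop :=
  ∀ r : ℕ, 1 ≤ r → initialIdeal ord (secantIdeal r I) = secantIdeal r (initialIdeal ord I)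

/-- `G` is a Gröbner basis of `I`: a finite set of nonzero elements of `I` whose leading terms
generate the initial ideal of `I`. -/
def IsGroebnerBasis {K σ : Type*} [Field K] (ord : MonomialOrder σ)
    (G : Set (MvPolynomial σ K)) (I : Ideal (MvPolynomial σ K)) : Prop :=
  G.Finite ∧ 0 ∉ G ∧ G ⊆ (I : Set (MvPolynomial σ K)) ∧
    Ideal.span (ord.leadingTerm '' G) = initialIdeal ord I

/-- The set of `t`-minors of a matrix: choose `t` rows and `t` columns in increasing order. -/
def minors {R : Type*} [CommRing R] {p q : ℕ} (t : ℕ) (A : Matrix (Fin p) (Fin q) R) : Set R :=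
  {d | ∃ (f : Fin t ↪o Fin p) (g : Fin t ↪o Fin q), d = (A.submatrix f g).det}

/-- The index of the entry in row `i`, column `j` (counted from `0`) of `X_t` is less than `n`. -/
theorem entry_lt {n c t : ℕ} (i : Fin t) (j : Fin (n - (t - 1) * c)) :
    (j : ℕ) + (i : ℕ) * c < n := by
  have hi : (i : ℕ) * c ≤ (t - 1) * c := Nat.mul_le_mul_right c (by omega)
  omega

/-- The extended Hankel matrix `X_t` with `t` rows and `n - (t - 1) c` columns; counting rows,
columns and variables from `0`, its `(i, j)` entry is the variable with index `j + i c`. -/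
def hankelMatrix (K : Type*) [Field K] (n c t : ℕ) :
    Matrix (Fin t) (Fin (n - (t - 1) * c)) (MvPolynomial (Fin n) K) :=
  Matrix.of fun i j => X ⟨(j : ℕ) + (i : ℕ) * c, entry_lt i j⟩

/-- The ideal `I_t` generated by the `t`-minors of `X_t` (zero if `X_t` has fewer than `t`
columns). -/
def hankelIdeal (K : Type*) [Field K] (n c t : ℕ) : Ideal (MvPolynomial (Fin n) K) :=
  Ideal.span (minors t (hankelMatrix K n c t))

end

end ExtHankel

/-!
Number the variables from `0`. The diagonal term of a `t`-minor of `X_t` is its leading term, and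
these diagonal terms are exactly the squarefree monomials `x_{i_1} ⋯ x_{i_t}` with
`i_{k + 1} - i_k > c` (`image_leadingTerm_minors`). They generate `gapIdeal K n c t`; for `t = 2` it
is the edge ideal of the graph `G` that joins `i` and `j` when `|i - j| > c`, and in general its
generators are the cliques of size `t`.

The initial ideal of the secant ideal is squeezed,
`gapIdeal (r + 1) ⊆ in(I_{r + 1}) ⊆ in(I_2^{r}) ⊆ gapIdeal (r + 1)`.

* The middle inclusion holds as `I_{r + 1} ⊆ I_2^{r}` (`hankelIdeal_le_secantIdeal`): modulo the
  ideal of the join, `X_{r + 1}` is a sum of `r` matrices whose 2-minors vanish.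
* For the last one (`exists_gapExponent_le_degree`) let `m` be the leading monomial of `f` in the
  secant ideal. If its support has no clique of size `r + 1`, then, `G` being perfect, it is colored
  by `r` sets of diameter at most `c` (`exists_gaps_or_coloring`), so that
  `m = m_1 ⋯ m_r`. The monomial map that gives `x_i` the multidegree `(⌊(i + k) / c⌋)_{k ∈ ℤ}`
  kills `I_2`, and each `m_j` is the smallest monomial with its image (`degLex_le_of_window`).
  Applied to `f(y_1 + ⋯ + y_r)`, the tensor product of `r` copies of this map gives zero, yet the
  coefficient at the image of `(m_1, …, m_r)` is the leading coefficient of `f`, a contradiction.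

So the leading terms of the minors generate `in(I_2^{r})`, and division with remainder gives
`I_2^{r} = I_{r + 1}`. For `r = 1` this yields `in(I_2) = gapIdeal 2`, and the same coloring
together with the pigeonhole principle shows `(gapIdeal 2)^{r} = gapIdeal (r + 1)`
(`secantIdeal_gapIdeal_le`, `gapIdeal_le_secantIdeal`), which is delightfulness.
-/

namespace ExtHankel

universe u v

/-! ### Membership in joins of ideals -/

section Join

variable {K : Type u} {σ : Type v} [Field K] {r : ℕ} {I : Fin r → Ideal (MvPolynomial σ K)}
  {f : MvPolynomial σ K}

/-- An element of the join vanishes at every sum `θ₁ + ⋯ + θ_r` of `S`-valued points `θ_j` of the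
varieties of the `I j`. -/
theorem aeval_sum_eq_zero_of_mem_joinIdeal {S : Type*} [CommRing S] [Algebra K S]
    (θ : Fin r → MvPolynomial σ K →ₐ[K] S) (hθ : ∀ j, ∀ g ∈ I j, θ j g = 0)
    (hf : f ∈ joinIdeal I) : aeval (fun i => ∑ j, θ j (X i)) f = 0 := by
  let Θ : MvPolynomial (σ ⊕ Fin r × σ) K →ₐ[K] S :=
    aeval (Sum.elim (fun i => ∑ j, θ j (X i)) fun q => θ q.1 (X q.2))
  have hΘ : ∀ j, Θ.comp (rename fun i : σ => Sum.inr (j, i)) = θ j := fun j => by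
    ext i; simp [Θ]
  have hle : ((⨆ j : Fin r, Ideal.map
        (rename (fun i : σ => Sum.inr (j, i)) :
          MvPolynomial σ K →ₐ[K] MvPolynomial (σ ⊕ Fin r × σ) K) (I j)) ⊔
      Ideal.span (Set.range fun i : σ =>
        (∑ j : Fin r, X (Sum.inr (j, i)) - X (Sum.inl i) :
          MvPolynomial (σ ⊕ Fin r × σ) K))) ≤ RingHom.ker Θ := by
    refine sup_le (iSup_le fun j => ?_) ?_
    · rw [Ideal.map_le_iff_le_comap]
      intro g hg
      have := hθ j g hg
      rw [← hΘ j] at this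
      simpa [Ideal.mem_comap, RingHom.mem_ker] using this
    · rw [Ideal.span_le]
      rintro _ ⟨i, rfl⟩
      simp [RingHom.mem_ker, Θ]
  have h0 : Θ (rename Sum.inl f) = 0 := hle hf
  have : Θ.comp (rename Sum.inl) = aeval (fun i => ∑ j, θ j (X i)) := by
    ext i; simp [Θ]
  rw [← this]
  exact h0

/-- Converse to `aeval_sum_eq_zero_of_mem_joinIdeal`: it suffices to test the universal points,
with values in the quotient of `K[x, y]` by the ideal that defines the join. -/
theorem mem_joinIdeal_of_forall_aeval_sum_eq_zero
    (h : ∀ (S : Type (max u v)) [CommRing S] [Algebra K S]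
      (θ : Fin r → MvPolynomial σ K →ₐ[K] S), (∀ j, ∀ g ∈ I j, θ j g = 0) →
        aeval (fun i => ∑ j, θ j (X i)) f = 0) : f ∈ joinIdeal I := by
  unfold joinIdeal
  set J : Ideal (MvPolynomial (σ ⊕ Fin r × σ) K) := _ ⊔ _ with hJ
  have h1 := h (MvPolynomial (σ ⊕ Fin r × σ) K ⧸ J)
    (fun j => (Ideal.Quotient.mkₐ K J).comp (rename fun i : σ => Sum.inr (j, i))) (by
      intro j g hg
      rw [AlgHom.comp_apply, Ideal.Quotient.mkₐ_eq_mk, Ideal.Quotient.eq_zero_iff_mem]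
      exact Ideal.mem_sup_left
        (Ideal.mem_iSup_of_mem j (Ideal.mem_map_of_mem _ hg)))
  have h2 : aeval (fun i => ∑ j, ((Ideal.Quotient.mkₐ K J).comp
      (rename fun i : σ => (Sum.inr (j, i) : σ ⊕ Fin r × σ))) (X i)) =
      (Ideal.Quotient.mkₐ K J).comp (rename Sum.inl) := by
    ext i
    have : (∑ j : Fin r, X (Sum.inr (j, i)) - X (Sum.inl i) :
        MvPolynomial (σ ⊕ Fin r × σ) K) ∈ J :=
      Ideal.mem_sup_right (Ideal.subset_span ⟨i, rfl⟩)
    rw [← Ideal.Quotient.eq_zero_iff_mem, map_sub, sub_eq_zero] at this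
    simpa using this
  rw [h2, AlgHom.comp_apply, Ideal.Quotient.mkₐ_eq_mk, Ideal.Quotient.eq_zero_iff_mem] at h1
  exact h1

end Join

/-! ### Determinants of sums of matrices with vanishing 2-minors -/

section Matrices

/-- If two rows have vanishing 2-minors, the terms of `s` and `s * swap i i'` in the Leibniz
expansion cancel, in every characteristic. -/
theorem det_eq_zero_of_two_rows {R m : Type*} [CommRing R] [Fintype m] [DecidableEq m]
    (A : Matrix m m R) {i i' : m} (hi : i ≠ i')
    (h : ∀ a b, A i a * A i' b = A i b * A i' a) : A.det = 0 := by
  rw [← Matrix.det_transpose, Matrix.det_apply']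
  refine Finset.sum_involution (fun s _ => s * Equiv.swap i i') ?_ ?_ (by simp) ?_
  · intro s _
    have hp : ∀ s : Equiv.Perm m, ∏ k, A.transpose (s k) k =
        (A i (s i) * A i' (s i')) * ∏ k ∈ (Finset.univ.erase i).erase i', A k (s k) := by
      intro s
      rw [← Finset.mul_prod_erase _ _ (Finset.mem_univ i), ← Finset.mul_prod_erase _ _
        (Finset.mem_erase.2 ⟨hi.symm, Finset.mem_univ i'⟩), mul_assoc]
      rfl
    rw [hp, hp, Equiv.Perm.sign_mul, Equiv.Perm.sign_swap hi]
    have : ∏ k ∈ (Finset.univ.erase i).erase i', A k ((s * Equiv.swap i i') k) =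
        ∏ k ∈ (Finset.univ.erase i).erase i', A k (s k) := by
      refine Finset.prod_congr rfl fun k hk => ?_
      simp only [Finset.mem_erase] at hk
      rw [Equiv.Perm.mul_apply, Equiv.swap_apply_of_ne_of_ne hk.2.1 hk.1]
    rw [this]
    simp only [Equiv.Perm.mul_apply, Equiv.swap_apply_left, Equiv.swap_apply_right]
    rw [h (s i') (s i)]
    push_cast
    ring
  · intro s _ _ hs
    have := congrArg (fun e : Equiv.Perm m => e i) (mul_eq_left.1 hs)
    simp at this
    exact hi this.symm
  · intro s _
    simp [mul_assoc]

/-- A sum of fewer than `card m` matrices with vanishing 2-minors is singular: expanding the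
determinant along rows, two rows of every summand come from the same matrix. -/
theorem det_sum_eq_zero {R m ι : Type*} [CommRing R] [Fintype m] [DecidableEq m] [Fintype ι]
    (hc : Fintype.card ι < Fintype.card m) (N : ι → Matrix m m R)
    (h : ∀ j i i' a b, N j i a * N j i' b = N j i b * N j i' a) :
    (Matrix.of fun i a => ∑ j, N j i a).det = 0 := by
  have h1 : (Matrix.of fun i a => ∑ j, N j i a) = fun i => ∑ j, N j i := by
    ext i a; simp
  have h2 := (Matrix.detRowAlternating (R := R) (n := m)).toMultilinearMap.map_sum
    (fun i j => N j i)
  rw [h1]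
  refine h2.trans (Finset.sum_eq_zero fun κ _ => ?_)
  obtain ⟨i, i', hne, he⟩ := Fintype.exists_ne_map_eq_of_card_lt κ hc
  refine det_eq_zero_of_two_rows (fun i => N (κ i) i) hne fun a b => ?_
  rw [he]
  exact h _ _ _ _ _

end Matrices

/-! ### Gap sequences and colorings by short windows -/

section Gaps

variable {n : ℕ}

/-- The exponents of the squarefree monomials of degree `t` whose indices, in increasing order,
have consecutive differences larger than `c`. -/
def gapExponents (n c t : ℕ) : Set (Fin n →₀ ℕ) :=
  {e | ∃ p : Fin t → Fin n, (∀ k l, k < l → (p k : ℕ) + c < p l) ∧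
    e = ∑ k, Finsupp.single (p k) 1}

theorem sum_single_le {t : ℕ} {p : Fin t → Fin n} (hp : Function.Injective p)
    {m : Fin n →₀ ℕ} (hm : ∀ k, p k ∈ m.support) : ∑ k, Finsupp.single (p k) 1 ≤ m := by
  intro i
  rw [Finsupp.finsetSum_apply]
  by_cases hi : ∃ k, p k = i
  · obtain ⟨k, rfl⟩ := hi
    rw [Finset.sum_eq_single k (fun l _ hl => by
      rw [Finsupp.single_apply, if_neg (fun h => hl (hp h))]) (by simp)]
    simpa [Nat.one_le_iff_ne_zero] using hm k
  · rw [Finset.sum_eq_zero]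
    · exact Nat.zero_le _
    · intro k _
      rw [Finsupp.single_apply, if_neg fun h => hi ⟨k, h⟩]

theorem injective_of_gaps {c t : ℕ} {p : Fin t → Fin n}
    (hp : ∀ k l, k < l → (p k : ℕ) + c < p l) : Function.Injective p := by
  have : StrictMono p := fun k l hkl => by
    have := hp k l hkl
    exact Fin.lt_def.2 (by omega)
  exact this.injective

/-- Perfectness of the graph that joins `i` and `j` when `|i - j| > c`: a set of vertices without a
clique of size `r + 2` is colored by `r + 1` independent sets, that is, by sets of diameter at
most `c`. -/
theorem exists_gaps_or_coloring (c : ℕ) (r : ℕ) (S : Finset (Fin n)) :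
    (∃ p : Fin (r + 2) → Fin n, (∀ k, p k ∈ S) ∧ ∀ k l, k < l → (p k : ℕ) + c < p l) ∨
      ∃ κ : Fin n → Fin (r + 1), ∀ i ∈ S, ∀ j ∈ S, κ i = κ j → (j : ℕ) ≤ i + c := by
  induction r generalizing S with
  | zero =>
    by_cases h : ∃ i ∈ S, ∃ j ∈ S, (i : ℕ) + c < j
    · obtain ⟨i, hi, j, hj, hij⟩ := h
      refine Or.inl ⟨![i, j], ?_, ?_⟩
      · simp [Fin.forall_fin_two, hi, hj]
      · simp [Fin.forall_fin_two, hij]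
    · push Not at h
      exact Or.inr ⟨fun _ => 0, fun i hi j hj _ => h i hi j hj⟩
  | succ r ih =>
    obtain rfl | hS := S.eq_empty_or_nonempty
    · exact Or.inr ⟨fun _ => 0, by simp⟩
    -- The window `[a, a + c]` at the minimum is one color class; recurse on what lies beyond it.
    set a := S.min' hS
    obtain ⟨p, hpS, hp⟩ | ⟨κ, hκ⟩ := ih (S.filter fun i : Fin n => (a : ℕ) + c < i)
    · refine Or.inl ⟨Fin.cons a p, ?_, ?_⟩
      · intro k
        refine Fin.cases (S.min'_mem hS) (fun k => ?_) k
        exact (Finset.mem_filter.1 (hpS k)).1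
      · intro k l
        refine Fin.cases ?_ (fun l => ?_) l
        · simp
        · refine Fin.cases (fun _ => ?_) (fun k hkl => ?_) k
          · exact (Finset.mem_filter.1 (hpS l)).2
          · exact hp k l (by simpa using hkl)
    · refine Or.inr ⟨fun i => if (a : ℕ) + c < i then (κ i).succ else 0, ?_⟩
      intro i hi j hj hij
      have hai : (a : ℕ) ≤ i := S.min'_le i hi
      by_cases h1 : (a : ℕ) + c < i <;> by_cases h2 : (a : ℕ) + c < j <;>
        simp only [h1, h2, if_true, if_false] at hij
      · exact hκ i (by simp [hi, h1]) j (by simp [hj, h2]) (Fin.succ_injective _ hij)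
      · omega
      · exact absurd hij.symm (Fin.succ_ne_zero _)
      · omega

end Gaps

/-! ### Leading terms of the Hankel minors -/

section Minors

open Finsupp

variable {n : ℕ}

theorem leadingTerm_eq_monomial {σ R : Type*} [CommRing R] (ord : MonomialOrder σ)
    {f : MvPolynomial σ R} {d : σ →₀ ℕ} (hd : d ∈ f.support)
    (h : ∀ e ∈ f.support, ord.toSyn e ≤ ord.toSyn d) :
    ord.leadingTerm f = monomial d (coeff d f) := by
  have : ord.degree f = d := ord.toSyn.injective
    (le_antisymm (ord.degree_le_iff.2 h) (ord.le_degree hd))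
  rw [MonomialOrder.leadingTerm, MonomialOrder.leadingCoeff, this]

/-- Among the monomials of the Leibniz expansion of a Hankel minor with column offsets `a`, the
diagonal one is strictly the largest. -/
theorem degLex_sum_single_lt {t c : ℕ} (hc : 1 ≤ c) {a : Fin t → ℕ} (ha : StrictMono a)
    {q : Fin t → Fin t → Fin n} (hq : ∀ i k, (q i k : ℕ) = a k + i * c)
    {s : Equiv.Perm (Fin t)} (hs : s ≠ 1) :
    MonomialOrder.degLex.toSyn (∑ k, single (q (s k) k) 1) <
      MonomialOrder.degLex.toSyn (∑ k, single (q k k) 1) := by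
  refine MonomialOrder.degLex_lt_iff.2 (DegLex.lt_iff.2 (Or.inr ⟨?_, ?_⟩))
  · simp
  have hne : (Finset.univ.filter fun k => s k ≠ k).Nonempty := by
    obtain ⟨k, hk⟩ : ∃ k, s k ≠ k := by
      by_contra! h
      exact hs (Equiv.ext h)
    exact ⟨k, by simpa using hk⟩
  -- The exponents first differ at the variable on the diagonal at the first index moved by `s`.
  set k₀ := Finset.min' _ hne
  have hk₀ : s k₀ ≠ k₀ := (Finset.mem_filter.1 (Finset.min'_mem _ hne)).2
  have hfix : ∀ k < k₀, s k = k := fun k hk => by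
    by_contra h
    exact absurd (Finset.min'_le _ k (by simpa using h)) (not_le.2 hk)
  have hge : ∀ k, k₀ ≤ k → k₀ ≤ s k := fun k hk => by
    by_contra! h
    exact absurd (s.injective (hfix _ h)) (ne_of_lt (h.trans_le hk))
  have hbig : ∀ k, k₀ ≤ k → q k₀ k₀ < q (s k) k := fun k hk => by
    rw [Fin.lt_def, hq, hq]
    have h1 : (k₀ : ℕ) * c ≤ s k * c := Nat.mul_le_mul_right c (hge k hk)
    obtain rfl | hlt := eq_or_lt_of_le hk
    · have h2 : (k₀ : ℕ) * c < s k₀ * c :=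
        Nat.mul_lt_mul_of_pos_right (Fin.lt_def.1 (lt_of_le_of_ne (hge k₀ le_rfl) hk₀.symm)) hc
      omega
    · have := ha hlt
      omega
  have hdiag : ∀ k, k₀ < k → q k₀ k₀ < q k k := fun k hk => by
    rw [Fin.lt_def, hq, hq]
    have := ha hk
    have : (k₀ : ℕ) * c ≤ k * c := Nat.mul_le_mul_right c hk.le
    omega
  refine ⟨q k₀ k₀, fun i hi => ?_, ?_⟩
  · simp only [ofDegLex_toDegLex, Finsupp.finsetSum_apply, ofLex_toLex]
    refine Finset.sum_congr rfl fun k _ => ?_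
    obtain hk | hk := lt_or_ge k k₀
    · rw [hfix k hk]
    · rw [single_apply, single_apply, if_neg, if_neg]
      · rintro rfl
        obtain rfl | hlt := eq_or_lt_of_le hk
        · exact lt_irrefl _ hi
        · exact lt_asymm hi (hdiag k hlt)
      · rintro rfl
        exact lt_asymm hi (hbig k hk)
  · simp only [ofDegLex_toDegLex, Finsupp.finsetSum_apply, ofLex_toLex]
    refine Finset.sum_lt_sum (fun k _ => ?_) ⟨k₀, Finset.mem_univ _, ?_⟩
    · obtain hk | hk := lt_or_ge k k₀
      · rw [hfix k hk]
      · rw [single_apply, if_neg (hbig k hk).ne']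
        exact Nat.zero_le _
    · rw [single_apply, if_neg (hbig k₀ le_rfl).ne', single_eq_same]
      exact Nat.zero_lt_one

theorem leadingTerm_det {K : Type*} [Field K] {t c : ℕ} (hc : 1 ≤ c) {a : Fin t → ℕ}
    (ha : StrictMono a) {q : Fin t → Fin t → Fin n} (hq : ∀ i k, (q i k : ℕ) = a k + i * c) :
    MonomialOrder.degLex.leadingTerm
        (Matrix.of fun i k => (X (q i k) : MvPolynomial (Fin n) K)).det =
      monomial (∑ k, single (q k k) 1) 1 := by
  classical
  have hterm : ∀ s : Equiv.Perm (Fin t),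
      ∏ k, (Matrix.of fun i k => (X (q i k) : MvPolynomial (Fin n) K)) (s k) k =
        monomial (∑ k, single (q (s k) k) 1) 1 := fun s => by
    simp [X, monomial_sum_one]
  have hcoeff : ∀ e, coeff e (Matrix.of fun i k => (X (q i k) : MvPolynomial (Fin n) K)).det =
      ∑ s : Equiv.Perm (Fin t), if (∑ k, single (q (s k) k) 1) = e then
        ((Equiv.Perm.sign s : ℤ) : K) else 0 := fun e => by
    rw [Matrix.det_apply', coeff_sum]
    refine Finset.sum_congr rfl fun s _ => ?_
    rw [hterm, ← map_intCast (C : K →+* MvPolynomial (Fin n) K), coeff_C_mul, coeff_monomial]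
    simp
  have hone : coeff (∑ k, single (q k k) 1)
      (Matrix.of fun i k => (X (q i k) : MvPolynomial (Fin n) K)).det = 1 := by
    rw [hcoeff, Finset.sum_eq_single 1]
    · simp
    · intro s _ hs
      rw [if_neg]
      intro h
      exact (degLex_sum_single_lt hc ha hq hs).ne (by rw [h])
    · simp
  rw [leadingTerm_eq_monomial _ (d := ∑ k, single (q k k) 1), hone]
  · rw [MvPolynomial.mem_support_iff, hone]
    exact one_ne_zero
  · intro e he
    rw [MvPolynomial.mem_support_iff, hcoeff] at he
    obtain ⟨s, _, hs⟩ := Finset.exists_ne_zero_of_sum_ne_zero he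
    have hse : ∑ k, single (q (s k) k) 1 = e := by
      by_contra h
      exact hs (if_neg h)
    rw [← hse]
    by_cases h1 : s = 1
    · subst h1; rfl
    · exact (degLex_sum_single_lt hc ha hq h1).le

theorem add_mul_lt_of_gaps {c t : ℕ} {p : Fin t → Fin n}
    (hp : ∀ k l, k < l → (p k : ℕ) + c < p l) {k l : Fin t} (hkl : k < l) :
    (p k : ℕ) + (l - k) * c < p l := by
  obtain ⟨k, hk⟩ := k
  obtain ⟨l, hl⟩ := l
  simp only [Fin.mk_lt_mk] at hkl
  induction l, hkl using Nat.le_induction with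
  | base => simpa using hp ⟨k, hk⟩ ⟨k + 1, hl⟩ (by simp)
  | succ l hkl ih =>
    have h1 := ih (by omega)
    have h2 := hp ⟨l, by omega⟩ ⟨l + 1, hl⟩ (by simp)
    simp only [Nat.succ_eq_add_one] at *
    have h3 : (l + 1 - k) * c = (l - k) * c + c := by
      rw [Nat.sub_add_comm (by omega), Nat.add_mul, one_mul]
    omega

/-- Column choices `g` and gap sequences `p` correspond through `p k = g k + k * c`. -/
theorem image_leadingTerm_minors {K : Type*} [Field K] {c : ℕ} (hc : 1 ≤ c) (t : ℕ) :
    MonomialOrder.degLex.leadingTerm '' minors t (hankelMatrix K n c t) =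
      (fun e => monomial e (1 : K)) '' gapExponents n c t := by
  have hid : ∀ f : Fin t ↪o Fin t, ∀ k, f k = k := fun f k => by
    have hf := (Finite.injective_iff_surjective.1 f.injective).range_eq
    exact congrFun ((StrictMono.range_inj f.strictMono strictMono_id).1 (by simp [hf])) k
  have hmain : ∀ (f : Fin t ↪o Fin t) (g : Fin t ↪o Fin (n - (t - 1) * c)),
      MonomialOrder.degLex.leadingTerm ((hankelMatrix K n c t).submatrix f g).det =
        monomial (∑ k, single (⟨(g k : ℕ) + k * c, entry_lt _ _⟩ : Fin n) 1) 1 := by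
    intro f g
    rw [← leadingTerm_det (K := K) hc (a := fun k => (g k : ℕ)) (fun k l h => g.strictMono h)
      (q := fun i k => ⟨(g k : ℕ) + i * c, entry_lt _ _⟩) (fun _ _ => rfl)]
    congr 2
    ext1 i k
    simp [hankelMatrix, hid]
  apply Set.Subset.antisymm
  · rintro _ ⟨_, ⟨f, g, rfl⟩, rfl⟩
    refine ⟨_, ⟨_, fun k l hkl => ?_, rfl⟩, (hmain f g).symm⟩
    have h1 : (g k : ℕ) < g l := g.strictMono hkl
    have h2 : ((k : ℕ) + 1) * c ≤ l * c := Nat.mul_le_mul_right c hkl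
    rw [Nat.add_mul, one_mul] at h2
    dsimp only
    omega
  · rintro _ ⟨_, ⟨p, hp, rfl⟩, rfl⟩
    -- The column `p k - k * c` is a true subtraction and lies within the width of `X_t`.
    have hlow : ∀ k : Fin t, (k : ℕ) * c ≤ p k := fun k => by
      obtain h0 | h0 := Nat.eq_zero_or_pos (k : ℕ)
      · simp [h0]
      · have := add_mul_lt_of_gaps hp (k := ⟨0, by omega⟩) (l := k) (Fin.lt_def.2 h0)
        simp only [Nat.sub_zero] at this
        omega
    have hup : ∀ k : Fin t, (p k : ℕ) - k * c < n - (t - 1) * c := fun k => by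
      have h1 := k.2
      have h2 := hlow k
      have h3 : (t - 1) * c = k * c + (t - 1 - k) * c := by
        rw [← Nat.add_mul]; congr 1; omega
      by_cases h0 : (k : ℕ) = t - 1
      · have h4 := (p k).2
        rw [← h0]
        omega
      · have := add_mul_lt_of_gaps hp (k := k) (l := ⟨t - 1, by omega⟩)
          (Fin.lt_def.2 (by simp only; omega))
        have := (p ⟨t - 1, by omega⟩).2
        dsimp only at *
        omega
    have hmono : StrictMono fun k => (⟨(p k : ℕ) - k * c, hup k⟩ : Fin (n - (t - 1) * c)) := by
      intro k l hkl
      have h1 := add_mul_lt_of_gaps hp hkl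
      have h2 := hlow k
      have h3 : (l : ℕ) * c = k * c + (l - k) * c := by
        rw [← Nat.add_mul]; congr 1; have := Fin.lt_def.1 hkl; omega
      rw [Fin.mk_lt_mk]
      omega
    refine ⟨_, ⟨RelEmbedding.refl _, OrderEmbedding.ofStrictMono _ hmono, rfl⟩, ?_⟩
    rw [hmain]
    dsimp only
    congr 2
    refine Finset.sum_congr rfl fun k _ => ?_
    congr 1
    ext
    simp [hlow k]

end Minors

/-! ### Minimality in toric fibers and coefficients under `x_i ↦ y_{1i} + ⋯ + y_{ri}` -/

section Toric

open Finsupp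

variable {n : ℕ}

/-- Give `x_i` the multidegree `(⌊(i + k) / c⌋)_{k ∈ ℤ}`, for which the binomials
`x_a x_{b + c} - x_{a + c} x_b` are homogeneous. A monomial whose support lies in a window of
length `c` is the smallest one of its multidegree. -/
theorem degLex_le_of_window {c : ℕ} (hc : 1 ≤ c) {m u : Fin n →₀ ℕ}
    (hm : ∀ i ∈ m.support, ∀ j ∈ m.support, (j : ℕ) ≤ i + c)
    (h : ∀ k : ℤ, ∑ i, (m i : ℤ) * (((i : ℕ) + k) / c) = ∑ i, (u i : ℤ) * (((i : ℕ) + k) / c)) :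
    MonomialOrder.degLex.toSyn m ≤ MonomialOrder.degLex.toSyn u := by
  have hc0 : (c : ℤ) ≠ 0 := by omega
  -- The entries `k = c` and `k = 0` of the multidegree differ by the total degree.
  have hdeg : m.degree = u.degree := by
    have h1 : ∀ w : Fin n →₀ ℕ, ∑ i, (w i : ℤ) * (((i : ℕ) + (c : ℤ)) / c) -
        ∑ i, (w i : ℤ) * (((i : ℕ) + (0 : ℤ)) / c) = w.degree := fun w => by
      rw [← Finset.sum_sub_distrib, Finsupp.degree_eq_sum]
      push_cast
      refine Finset.sum_congr rfl fun i _ => ?_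
      rw [Int.add_ediv_of_dvd_right dvd_rfl, Int.ediv_self hc0, add_zero]
      ring
    have := h1 m
    rw [h c, h 0, h1 u] at this
    exact_mod_cast this.symm
  by_contra hlt
  rw [not_le] at hlt
  obtain hlt | ⟨-, i₀, heq, hi₀⟩ := DegLex.lt_iff.1 (MonomialOrder.degLex_lt_iff.1 hlt)
  · exact hlt.ne hdeg.symm
  simp only [ofDegLex_toDegLex, ofLex_toLex] at heq hi₀
  have hmi₀ : i₀ ∈ m.support := Finsupp.mem_support_iff.2 (by omega)
  -- The weight `⌊(i - i₀ - 1) / c⌋` is `-1` at `i₀`, vanishes on the rest of the window that starts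
  -- at `i₀`, and is nonnegative beyond it, where `m` vanishes.
  have h0 := h (-(i₀ : ℕ) - 1)
  refine h0.not_lt (Finset.sum_lt_sum (fun i _ => ?_) ⟨i₀, Finset.mem_univ _, ?_⟩)
  · obtain hi | rfl | hi := lt_trichotomy i i₀
    · rw [heq i hi]
    · have : ((i : ℕ) + (-(i : ℕ) - 1) : ℤ) / c = -1 := by
        rw [Int.ediv_eq_iff_of_pos (by omega)]
        omega
      rw [this]
      omega
    · have hi' := Fin.lt_def.1 hi
      have hnn : 0 ≤ ((i : ℕ) + (-(i₀ : ℕ) - 1) : ℤ) / c :=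
        Int.ediv_nonneg (by omega) (by omega)
      by_cases hic : (i : ℕ) ≤ i₀ + c
      · rw [Int.ediv_eq_zero_of_lt (by omega) (by omega)]
        simp
      · have : m i = 0 := by
          by_contra hmi
          exact hic (hm i₀ hmi₀ i (Finsupp.mem_support_iff.2 hmi))
        rw [this]
        simp only [Nat.cast_zero, zero_mul]
        positivity
  · have : ((i₀ : ℕ) + (-(i₀ : ℕ) - 1) : ℤ) / c = -1 := by
      rw [Int.ediv_eq_iff_of_pos (by omega)]
      omega
    rw [this]
    omega

/-- A polynomial killed by a monomial map has at least two monomials in every fiber that its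
support meets. -/
theorem exists_ne_of_aeval_single_eq_zero {K ι A : Type*} [Field K] [AddCommMonoid A] (L : ι → A)
    {F : MvPolynomial ι K} (hF : aeval (fun i => AddMonoidAlgebra.single (L i) (1 : K)) F = 0)
    {v₀ : ι →₀ ℕ} (hv₀ : v₀ ∈ F.support) :
    ∃ v ∈ F.support, v ≠ v₀ ∧ weight L v = weight L v₀ := by
  classical
  have hmon : ∀ v : ι →₀ ℕ, ∀ a : K,
      aeval (fun i => AddMonoidAlgebra.single (L i) (1 : K)) (monomial v a) =
        AddMonoidAlgebra.single (weight L v) a := by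
    intro v a
    have hprod : (v.prod fun i k => AddMonoidAlgebra.single (L i) (1 : K) ^ k) =
        AddMonoidAlgebra.single (weight L v) 1 := by
      induction v using Finsupp.induction_linear with
      | zero => simp [AddMonoidAlgebra.one_def]
      | add v w hv hw =>
        rw [Finsupp.prod_add_index' (by simp) (fun _ _ _ => pow_add _ _ _), hv, hw, map_add,
          AddMonoidAlgebra.single_mul_single, one_mul]
      | single i k => simp [AddMonoidAlgebra.single_pow, Finsupp.weight_apply]
    rw [aeval_monomial, hprod, AddMonoidAlgebra.coe_algebraMap]
    simp [AddMonoidAlgebra.single_mul_single]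
  by_contra! hcon
  rw [F.as_sum, map_sum] at hF
  have h1 := congrArg (fun z => z.coeff (weight L v₀)) hF
  simp only [hmon, AddMonoidAlgebra.coeff_sum, Finsupp.finsetSum_apply,
    AddMonoidAlgebra.coeff_single, AddMonoidAlgebra.coeff_zero, Finsupp.coe_zero,
    Pi.zero_apply] at h1
  rw [Finset.sum_eq_single v₀, Finsupp.single_eq_same] at h1
  · exact MvPolynomial.mem_support_iff.1 hv₀ h1
  · intro v hv hne
    rw [Finsupp.single_apply, if_neg (hcon v hv hne)]
  · exact fun h => absurd hv₀ h

/-- The substitution `x_i ↦ y_{1i} + ⋯ + y_{ri}`. -/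
noncomputable def sumVars (K : Type*) [Field K] (σ : Type*) (r : ℕ) :
    MvPolynomial σ K →ₐ[K] MvPolynomial (Fin r × σ) K :=
  aeval fun i => ∑ j, X (j, i)

variable {K : Type*} [Field K] {σ : Type*}

/-- The substitution `sumVars` preserves the grading in which `y_{ji}` and `x_i` have the same
multidegree, so a monomial of the image of `f` comes from the monomial of `f` obtained by
`y_{ji} ↦ x_i`. -/
theorem mapDomain_snd_mem_support {r : ℕ} {f : MvPolynomial σ K} {v : Fin r × σ →₀ ℕ}
    (hv : v ∈ (sumVars K σ r f).support) : v.mapDomain Prod.snd ∈ f.support := by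
  classical
  set w : Fin r × σ → (σ →₀ ℕ) := fun q => single q.2 1
  have hw : ∀ v, weight w v = v.mapDomain Prod.snd := fun v => by
    simp [weight_apply, w, Finsupp.mapDomain]
  rw [f.as_sum, map_sum] at hv
  obtain ⟨u, hu, hvu⟩ := Finset.mem_biUnion.1 (support_sum hv)
  have hhom : IsWeightedHomogeneous w (sumVars K σ r (monomial u (coeff u f))) u := by
    rw [sumVars, aeval_monomial]
    refine IsWeightedHomogeneous.C_mul ?_ _
    have h := IsWeightedHomogeneous.prod u.support
      (fun i => (∑ j, X (j, i) : MvPolynomial (Fin r × σ) K) ^ u i) (fun i => u i • single i 1)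
      (w := w) (fun i _ => IsWeightedHomogeneous.pow
        (IsWeightedHomogeneous.sum _ _ _ fun j _ => isWeightedHomogeneous_X K w (j, i)) _)
    have hu : ∑ i ∈ u.support, u i • single i 1 = u := by
      conv_rhs => rw [← u.sum_single]
      simp [Finsupp.sum]
    rwa [hu] at h
  have := hhom (MvPolynomial.mem_support_iff.1 hvu)
  rw [← hw, this]
  exact hu

/-- Setting variables to zero does not change the coefficients of the monomials without them. -/
theorem coeff_aeval_ite_X (P : σ → Prop) [DecidablePred P] (f : MvPolynomial σ K)
    {v : σ →₀ ℕ} (hv : ∀ i ∈ v.support, P i) :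
    coeff v (aeval (fun i => if P i then (X i : MvPolynomial σ K) else 0) f) = coeff v f := by
  classical
  induction f using MvPolynomial.induction_on' with
  | add p q hp hq => rw [map_add, coeff_add, hp, hq, coeff_add]
  | monomial u a =>
    by_cases hu : ∀ i ∈ u.support, P i
    · congr 1
      rw [aeval_monomial, monomial_eq]
      congr 1
      exact Finset.prod_congr rfl fun i hi => by simp only [if_pos (hu i hi)]
    · push Not at hu
      obtain ⟨i, hi, hPi⟩ := hu
      rw [aeval_monomial, Finsupp.prod, Finset.prod_eq_zero hi, mul_zero, coeff_zero,
        coeff_monomial, if_neg]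
      · rintro rfl
        exact hPi (hv i hi)
      · rw [if_neg hPi, zero_pow (Finsupp.mem_support_iff.1 hi)]

/-- The coefficient of `∏ y_{κ(i) i} ^ (m i)` in the image of `x ^ m` is a multinomial coefficient
equal to `1`, because each `i` occurs with one color only. -/
theorem coeff_sumVars_of_coloring {r : ℕ} (κ : σ → Fin r) (f : MvPolynomial σ K) (m : σ →₀ ℕ) :
    coeff (m.mapDomain fun i => (κ i, i)) (sumVars K σ r f) = coeff m f := by
  classical
  have hinj : Function.Injective fun i => (κ i, i) := fun i j h => (Prod.ext_iff.1 h).2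
  rw [← coeff_aeval_ite_X (fun q : Fin r × σ => κ q.2 = q.1)]
  · have : (aeval fun q : Fin r × σ => if κ q.2 = q.1 then
        (X q : MvPolynomial (Fin r × σ) K) else 0).comp (sumVars K σ r) =
        rename fun i => (κ i, i) := by
      ext1 i
      simp [sumVars]
    rw [← AlgHom.comp_apply, this, coeff_rename_mapDomain _ hinj]
  · intro q hq
    obtain ⟨i, _, rfl⟩ := Finset.mem_image.1 (mapDomain_support hq)
    rfl

end Toric

/-! ### Secants of the monomial ideal of gap pairs -/

/-- The ideal generated by the squarefree monomials with exponent in `gapExponents n c t`. -/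
noncomputable def gapIdeal (K : Type*) [Field K] (n c t : ℕ) : Ideal (MvPolynomial (Fin n) K) :=
  Ideal.span ((fun e => monomial e (1 : K)) '' gapExponents n c t)

section MonomialSecants

variable {K : Type*} [Field K] {n : ℕ}

theorem mem_gapIdeal {c t : ℕ} {f : MvPolynomial (Fin n) K} :
    f ∈ gapIdeal K n c t ↔ ∀ m ∈ f.support, ∃ e ∈ gapExponents n c t, e ≤ m :=
  mem_ideal_span_monomial_image

/-- Expanding a product of `r + 1` sums of `r` terms, every summand has two factors with the same
index `j`. -/
theorem gapIdeal_le_secantIdeal (c r : ℕ) :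
    gapIdeal K n c (r + 1) ≤ secantIdeal r (gapIdeal K n c 2) := by
  rw [gapIdeal, Ideal.span_le]
  rintro _ ⟨_, ⟨p, hp, rfl⟩, rfl⟩
  refine mem_joinIdeal_of_forall_aeval_sum_eq_zero fun S _ _ θ hθ => ?_
  have hpair : ∀ j k l, k < l → θ j (X (p k)) * θ j (X (p l)) = 0 := fun j k l hkl => by
    rw [← map_mul]
    refine hθ j _ (Ideal.subset_span ⟨_, ⟨![p k, p l], ?_, rfl⟩, ?_⟩)
    · simpa [Fin.forall_fin_two] using hp k l hkl
    · simp [X]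
  have hX : monomial (∑ k, Finsupp.single (p k) 1) (1 : K) = ∏ k, X (p k) := by
    simp [monomial_sum_one, X]
  simp only [hX, map_prod, aeval_X]
  rw [Finset.prod_univ_sum]
  refine Finset.sum_eq_zero fun κ _ => ?_
  obtain ⟨k, l, hne, hkl⟩ := Fintype.exists_ne_map_eq_of_card_lt κ (by simp)
  rw [← Finset.mul_prod_erase _ _ (Finset.mem_univ k), ← Finset.mul_prod_erase _ _
    (Finset.mem_erase.2 ⟨hne.symm, Finset.mem_univ l⟩), ← mul_assoc, hkl]
  obtain h | h := lt_or_gt_of_ne hne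
  · rw [hpair _ _ _ h, zero_mul]
  · rw [mul_comm (θ _ _), hpair _ _ _ h, zero_mul]

/-- If the support of a monomial `m` of `f` has a coloring by windows, keep in the `j`-th point only
the variables of color `j`; the sum of these points keeps exactly the variables of `m`. -/
theorem secantIdeal_gapIdeal_le (c r : ℕ) :
    secantIdeal (r + 1) (gapIdeal K n c 2) ≤ gapIdeal K n c (r + 2) := by
  classical
  intro f hf
  rw [mem_gapIdeal]
  intro m hm
  obtain ⟨p, hpm, hp⟩ | ⟨κ, hκ⟩ := exists_gaps_or_coloring c r m.support
  · exact ⟨_, ⟨p, hp, rfl⟩, sum_single_le (injective_of_gaps hp) hpm⟩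
  exfalso
  have h0 := aeval_sum_eq_zero_of_mem_joinIdeal (S := MvPolynomial (Fin n) K)
    (fun j => aeval fun i => if i ∈ m.support ∧ κ i = j then X i else 0) (fun j g hg => by
      have hle : gapIdeal K n c 2 ≤ RingHom.ker (aeval (R := K) fun i =>
          if i ∈ m.support ∧ κ i = j then (X i : MvPolynomial (Fin n) K) else 0) := by
        rw [gapIdeal, Ideal.span_le]
        rintro _ ⟨_, ⟨p, hp, rfl⟩, rfl⟩
        have hX : monomial (∑ k, Finsupp.single (p k) 1) (1 : K) = X (p 0) * X (p 1) := by
          simp [X, Fin.sum_univ_two]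
        simp only [SetLike.mem_coe, RingHom.mem_ker, hX, map_mul, aeval_X]
        by_cases h0 : p 0 ∈ m.support ∧ κ (p 0) = j
        · by_cases h1 : p 1 ∈ m.support ∧ κ (p 1) = j
          · have h2 := hκ _ h0.1 _ h1.1 (h0.2.trans h1.2.symm)
            have h3 := hp 0 1 (by simp)
            omega
          · rw [if_neg h1, mul_zero]
        · rw [if_neg h0, zero_mul]
      exact hle hg) hf
  have hsum : (fun i => ∑ j, (aeval fun i => if i ∈ m.support ∧ κ i = j then
      (X i : MvPolynomial (Fin n) K) else 0) (X i : MvPolynomial (Fin n) K)) =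
      fun i => if i ∈ m.support then X i else 0 := by
    funext i
    simp only [aeval_X]
    by_cases hi : i ∈ m.support <;> simp [hi]
  rw [hsum] at h0
  have := coeff_aeval_ite_X (fun i => i ∈ m.support) f (v := m) fun _ h => h
  rw [h0, coeff_zero] at this
  exact MvPolynomial.mem_support_iff.1 hm this.symm

end MonomialSecants

/-! ### Secants of the ideal of the scroll -/

section HankelIdeals

variable {K : Type*} [Field K] {n c : ℕ}

/-- The vanishing of the 2-minors of `X_2` propagates to all minors
`x_a x_{b + k c} - x_{a + k c} x_b`. The values are extended by zero to a function on `ℕ`. -/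
theorem exists_mul_eq_mul_of_hankelIdeal_le_ker {S : Type*} [CommRing S] [Algebra K S]
    {θ : MvPolynomial (Fin n) K →ₐ[K] S} (hθ : ∀ g ∈ hankelIdeal K n c 2, θ g = 0) :
    ∃ Y : ℕ → S, (∀ i : Fin n, θ (X i) = Y i) ∧ ∀ k a b, a + k * c < n → b + k * c < n →
      Y a * Y (b + k * c) = Y (a + k * c) * Y b := by
  let Y : ℕ → S := fun i => if h : i < n then θ (X ⟨i, h⟩) else 0
  have hY : ∀ i : Fin n, θ (X i) = Y i := fun i => by simp [Y]
  refine ⟨Y, hY, ?_⟩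
  have hlt : ∀ a b, b + c < n → a < b → Y a * Y (b + c) = Y (a + c) * Y b := by
    intro a b hb hab
    have hmono : StrictMono ![(⟨a, by omega⟩ : Fin (n - (2 - 1) * c)), ⟨b, by omega⟩] := by
      intro i j hij
      fin_cases i <;> fin_cases j <;> simp_all
    have h := hθ _ (Ideal.subset_span ⟨RelEmbedding.refl _,
      OrderEmbedding.ofStrictMono _ hmono, rfl⟩)
    rw [Matrix.det_fin_two, map_sub, map_mul, map_mul, sub_eq_zero] at h
    simp only [hankelMatrix, Matrix.submatrix_apply, Matrix.of_apply, hY] at h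
    simpa [mul_comm] using h
  have hone : ∀ a b, a + c < n → b + c < n → Y a * Y (b + c) = Y (a + c) * Y b := by
    intro a b ha hb
    obtain h | rfl | h := lt_trichotomy a b
    · exact hlt a b hb h
    · exact mul_comm _ _
    · rw [mul_comm, ← hlt b a ha h, mul_comm]
  intro k
  induction k with
  | zero => simp
  | succ k ih =>
    intro a b ha hb
    rw [add_one_mul, ← add_assoc] at ha hb ⊢
    rw [hone a (b + k * c) (by omega) hb, ih (a + c) b (by omega) (by omega), ← add_assoc,
      add_right_comm]

/-- At a sum of `r` points of the scroll, a submatrix of `X_{r + 1}` is a sum of `r` matrices with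
vanishing 2-minors. -/
theorem hankelIdeal_le_secantIdeal (r : ℕ) :
    hankelIdeal K n c (r + 1) ≤ secantIdeal r (hankelIdeal K n c 2) := by
  rw [hankelIdeal, Ideal.span_le]
  rintro _ ⟨f, g, rfl⟩
  refine mem_joinIdeal_of_forall_aeval_sum_eq_zero fun S _ _ θ hθ => ?_
  rw [AlgHom.map_det]
  have hlt : ∀ i l, (g l : ℕ) + (f i : ℕ) * c < n := fun i l => entry_lt _ _
  have hN := det_sum_eq_zero (by simp) (fun j => Matrix.of fun i l => θ j (X ⟨_, hlt i l⟩)) (by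
    intro j
    obtain ⟨Y, hY, hmul⟩ := exists_mul_eq_mul_of_hankelIdeal_le_ker (hθ j)
    have hle : ∀ i i' a b, f i ≤ f i' → θ j (X ⟨_, hlt i a⟩) * θ j (X ⟨_, hlt i' b⟩) =
        θ j (X ⟨_, hlt i b⟩) * θ j (X ⟨_, hlt i' a⟩) := by
      intro i i' a b hi
      have hi' : (f i' : ℕ) * c = f i * c + (f i' - f i) * c := by
        rw [← Nat.add_mul]
        congr 1
        have := Fin.le_def.1 hi
        omega
      have ha := hlt i' a
      have hb := hlt i' b
      simp only [hY]
      rw [hi', ← add_assoc] at ha hb ⊢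
      rw [← add_assoc, hmul _ _ _ ha hb, mul_comm]
    intro i i' a b
    obtain h | h := le_total (f i) (f i')
    · exact hle i i' a b h
    · have := hle i' i b a h
      simp only [Matrix.of_apply]
      rw [mul_comm, this, mul_comm])
  rw [← hN]
  congr 1
  ext i l
  simp [hankelMatrix]

/-- The leading monomial `m` of an element `f` of the secant ideal of the scroll contains a long gap
sequence. Otherwise `m` splits by a coloring into `r + 1` monomials supported in windows, each
minimal in its toric fiber. Mapping each copy of the variables by the toric parametrization kills
`f(y₁ + ⋯ + y_{r + 1})`, but its support meets the fiber of this splitting in one monomial only,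
since the product of the parts of any other one would exceed `m`. -/
theorem exists_gapExponent_le_degree (hc : 1 ≤ c) {r : ℕ} {f : MvPolynomial (Fin n) K}
    (hf : f ∈ secantIdeal (r + 1) (hankelIdeal K n c 2)) (hf0 : f ≠ 0) :
    ∃ e ∈ gapExponents n c (r + 2), e ≤ MonomialOrder.degLex.degree f := by
  classical
  set m := MonomialOrder.degLex.degree f
  have hm : m ∈ f.support := MonomialOrder.degLex.degree_mem_support hf0
  obtain ⟨p, hpm, hp⟩ | ⟨κ, hκ⟩ := exists_gaps_or_coloring c r m.support
  · exact ⟨_, ⟨p, hp, rfl⟩, sum_single_le (injective_of_gaps hp) hpm⟩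
  exfalso
  let L : Fin (r + 1) × Fin n → (Fin (r + 1) → ℤ → ℤ) :=
    fun q => Pi.single q.1 fun k => ((q.2 : ℕ) + k) / c
  have hzero : aeval (fun i => ∑ j, (aeval fun i => AddMonoidAlgebra.single (L (j, i)) (1 : K))
      (X i : MvPolynomial (Fin n) K)) f = 0 := by
    refine aeval_sum_eq_zero_of_mem_joinIdeal (fun j => aeval fun i => _) (fun j g hg => ?_) hf
    have hle : hankelIdeal K n c 2 ≤ RingHom.ker
        (aeval fun i => AddMonoidAlgebra.single (L (j, i)) (1 : K)) := by
      rw [hankelIdeal, Ideal.span_le]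
      rintro _ ⟨f, g, rfl⟩
      have hL : ∀ a b : Fin 2, L (j, ⟨(g a : ℕ) + (f b : ℕ) * c, entry_lt _ _⟩) =
          Pi.single j (fun k : ℤ => (((g a : ℕ) : ℤ) + k) / (c : ℤ) + ((f b : ℕ) : ℤ)) := by
        intro a b
        simp only [L]
        congr 1
        funext k
        push_cast
        rw [add_right_comm, Int.add_mul_ediv_right _ _ (by omega)]
      rw [SetLike.mem_coe, RingHom.mem_ker, Matrix.det_fin_two]
      simp only [hankelMatrix, Matrix.submatrix_apply, Matrix.of_apply, map_sub, map_mul, aeval_X,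
        hL, AddMonoidAlgebra.single_mul_single, ← Pi.single_add]
      rw [sub_eq_zero]
      congr 2
      funext k
      simp only [Pi.add_apply]
      ring
    exact hle hg
  have hcomp : aeval (fun q => AddMonoidAlgebra.single (L q) (1 : K))
      (sumVars K (Fin n) (r + 1) f) = 0 := by
    rw [← hzero, ← AlgHom.comp_apply]
    congr 1
    ext1 i
    simp [sumVars]
  have hv₀ : m.mapDomain (fun i => (κ i, i)) ∈ (sumVars K (Fin n) (r + 1) f).support := by
    rw [MvPolynomial.mem_support_iff, coeff_sumVars_of_coloring]
    exact MvPolynomial.mem_support_iff.1 hm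
  obtain ⟨v, hv, hne, hw⟩ := exists_ne_of_aeval_single_eq_zero L hcomp hv₀
  let part : Fin (r + 1) → (Fin (r + 1) × Fin n →₀ ℕ) → (Fin n →₀ ℕ) :=
    fun j w => Finsupp.equivFunOnFinite.symm fun i => w (j, i)
  have hweight : ∀ w j k, Finsupp.weight L w j k =
      ∑ i, (part j w i : ℤ) * (((i : ℕ) + k) / c) := by
    intro w j k
    rw [Finsupp.weight_apply, Finsupp.sum_fintype _ _ (by simp), Fintype.sum_prod_type,
      Finset.sum_apply, Finset.sum_apply, Finset.sum_eq_single j]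
    · simp [L, part, Finset.sum_apply]
    · intro j' _ hj'
      simp [L, Finset.sum_apply, hj'.symm]
    · simp
  -- `part j w` is the exponent of the monomial `y ^ w` in the `j`-th copy of the variables.
  have hpart : ∀ w, w.mapDomain Prod.snd = ∑ j, part j w := by
    intro w
    ext i
    rw [Finsupp.mapDomain, Finsupp.sum_fintype _ _ (by simp), Fintype.sum_prod_type,
      Finsupp.finsetSum_apply, Finsupp.finsetSum_apply]
    refine Finset.sum_congr rfl fun j _ => ?_
    simp [part, Finsupp.finsetSum_apply, Finsupp.single_apply]
  have hm₀ : ∀ j i, part j (m.mapDomain fun i => (κ i, i)) i = if κ i = j then m i else 0 := by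
    intro j i
    have hinj : Function.Injective fun i => (κ i, i) := fun i j h => (Prod.ext_iff.1 h).2
    obtain rfl | hj := eq_or_ne (κ i) j
    · simpa [part] using Finsupp.mapDomain_apply hinj m i
    · rw [if_neg hj]
      refine Finsupp.mapDomain_of_notMem_range _ _ ?_
      rintro ⟨i', h⟩
      simp only [Prod.mk.injEq] at h
      exact hj (h.2 ▸ h.1)
  have hle : ∀ j, MonomialOrder.degLex.toSyn (part j (m.mapDomain fun i => (κ i, i))) ≤
      MonomialOrder.degLex.toSyn (part j v) := by
    intro j
    refine degLex_le_of_window hc (fun i hi i' hi' => ?_) fun k => ?_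
    · rw [Finsupp.mem_support_iff, hm₀, ne_eq, ite_eq_right_iff, Classical.not_imp] at hi hi'
      exact hκ i (Finsupp.mem_support_iff.2 hi.2) i' (Finsupp.mem_support_iff.2 hi'.2)
        (hi.1.trans hi'.1.symm)
    · rw [← hweight, ← hweight, hw]
  have hsum : ∑ j, MonomialOrder.degLex.toSyn (part j v) ≤
      ∑ j, MonomialOrder.degLex.toSyn (part j (m.mapDomain fun i => (κ i, i))) := by
    rw [← map_sum MonomialOrder.degLex.toSyn, ← map_sum MonomialOrder.degLex.toSyn, ← hpart,
      ← hpart, ← Finsupp.mapDomain_comp]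
    have : (Prod.snd ∘ fun i => (κ i, i)) = id := rfl
    rw [this, Finsupp.mapDomain_id]
    exact MonomialOrder.degLex.le_degree (mapDomain_snd_mem_support hv)
  have heq := (Finset.sum_eq_sum_iff_of_le fun j _ => hle j).1
    (le_antisymm (Finset.sum_le_sum fun j _ => hle j) hsum)
  apply hne
  ext ⟨j, i⟩
  have := MonomialOrder.degLex.toSyn.injective (heq j (Finset.mem_univ j))
  exact (DFunLike.congr_fun this i).symm

end HankelIdeals

/-! ### Generators detected by leading exponents -/

section GroebnerBases

/-- If the leading monomial of every nonzero element of `I` is divisible by that of an element of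
`B ⊆ I`, then `B` generates `I`: the remainder of a division by `B` is zero. -/
theorem le_span_of_exists_degree_le {σ K : Type*} [Field K] (ord : MonomialOrder σ)
    {I : Ideal (MvPolynomial σ K)} {B : Set (MvPolynomial σ K)} (hB0 : ∀ b ∈ B, b ≠ 0)
    (hBI : B ⊆ I) (h : ∀ f ∈ I, f ≠ 0 → ∃ b ∈ B, ord.degree b ≤ ord.degree f) :
    I ≤ Ideal.span B := by
  intro f hf
  obtain ⟨g, s, hfs, -, hs⟩ := ord.div_set (B := B)
    (fun b hb => (ord.leadingCoeff_ne_zero_iff.2 (hB0 b hb)).isUnit) f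
  have hg : Finsupp.linearCombination _ (fun b : B => (b : MvPolynomial σ K)) g ∈ Ideal.span B := by
    rw [Finsupp.linearCombination_apply]
    exact Submodule.sum_mem _ fun b _ => Ideal.mul_mem_left _ _ (Ideal.subset_span b.2)
  have hsI : s ∈ I := by
    have : s = f - Finsupp.linearCombination _ (fun b : B => (b : MvPolynomial σ K)) g := by
      rw [hfs]; ring
    rw [this]
    exact I.sub_mem hf (Ideal.span_le.2 hBI hg)
  obtain rfl : s = 0 := by
    by_contra hs0
    obtain ⟨b, hb, hle⟩ := h s hsI hs0
    exact hs _ (ord.degree_mem_support hs0) b hb hle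
  rw [hfs, add_zero]
  exact hg

end GroebnerBases

/-! ### The secant ideals and their initial ideals -/

section Secants

variable {K : Type*} [Field K] {n c : ℕ}

theorem ne_zero_of_mem_minors (hc : 1 ≤ c) {t : ℕ} {b : MvPolynomial (Fin n) K}
    (hb : b ∈ minors t (hankelMatrix K n c t)) : b ≠ 0 := by
  obtain ⟨e, -, he⟩ := (image_leadingTerm_minors hc t).subset ⟨b, hb, rfl⟩
  rintro rfl
  rw [MonomialOrder.leadingTerm_zero] at he
  exact one_ne_zero (monomial_eq_zero.1 he)

theorem minors_subset_secantIdeal (r : ℕ) :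
    minors (r + 1) (hankelMatrix K n c (r + 1)) ⊆ secantIdeal r (hankelIdeal K n c 2) :=
  fun _ hb => hankelIdeal_le_secantIdeal r (Ideal.subset_span hb)

theorem initialIdeal_secantIdeal_hankelIdeal (hc : 1 ≤ c) (r : ℕ) :
    initialIdeal MonomialOrder.degLex (secantIdeal (r + 1) (hankelIdeal K n c 2)) =
      gapIdeal K n c (r + 2) := by
  apply le_antisymm
  · rw [initialIdeal, Ideal.span_le]
    rintro _ ⟨f, hf, rfl⟩
    rw [SetLike.mem_coe, mem_gapIdeal]
    intro m hm
    have hf0 : f ≠ 0 := by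
      rintro rfl
      simp at hm
    rw [MonomialOrder.support_leadingTerm' hf0, Finset.mem_singleton] at hm
    rw [hm]
    exact exists_gapExponent_le_degree hc hf hf0
  · rw [gapIdeal, ← image_leadingTerm_minors hc]
    exact Ideal.span_mono (Set.image_mono (minors_subset_secantIdeal (r + 1)))

theorem secantIdeal_hankelIdeal (hc : 1 ≤ c) (r : ℕ) :
    secantIdeal (r + 1) (hankelIdeal K n c 2) = hankelIdeal K n c (r + 2) := by
  refine le_antisymm ?_ (hankelIdeal_le_secantIdeal (r + 1))
  refine le_span_of_exists_degree_le MonomialOrder.degLex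
    (B := minors (r + 2) (hankelMatrix K n c (r + 2))) (fun b hb => ne_zero_of_mem_minors hc hb)
    (minors_subset_secantIdeal (r + 1)) ?_
  intro f hf hf0
  obtain ⟨e, he, hle⟩ := exists_gapExponent_le_degree hc hf hf0
  obtain ⟨b, hb, hbe⟩ := (image_leadingTerm_minors (K := K) hc (r + 2)).superset ⟨e, he, rfl⟩
  refine ⟨b, hb, ?_⟩
  rw [← MonomialOrder.degree_leadingTerm, hbe]
  classical
  rw [MonomialOrder.degree_monomial, if_neg one_ne_zero]
  exact hle

theorem secantIdeal_one {σ : Type*} (I : Ideal (MvPolynomial σ K)) : secantIdeal 1 I = I := by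
  have haeval : ∀ {S : Type _} [CommRing S] [Algebra K S]
      (θ : Fin 1 → MvPolynomial σ K →ₐ[K] S), aeval (fun i => ∑ j, θ j (X i)) = θ 0 := by
    intro S _ _ θ
    ext i
    simp
  apply le_antisymm
  · intro f hf
    have h := aeval_sum_eq_zero_of_mem_joinIdeal (fun _ => Ideal.Quotient.mkₐ K I)
      (fun _ g hg => Ideal.Quotient.eq_zero_iff_mem.2 hg) hf
    rw [haeval] at h
    exact Ideal.Quotient.eq_zero_iff_mem.1 h
  · intro f hf
    refine mem_joinIdeal_of_forall_aeval_sum_eq_zero fun S _ _ θ hθ => ?_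
    rw [haeval]
    exact hθ 0 f hf

theorem initialIdeal_hankelIdeal_two (hc : 1 ≤ c) :
    initialIdeal MonomialOrder.degLex (hankelIdeal K n c 2) = gapIdeal K n c 2 := by
  rw [← initialIdeal_secantIdeal_hankelIdeal hc 0, secantIdeal_one]

end Secants

end ExtHankel

theorem mainTheorem4 {K : Type*} [Field K] (n c : ℕ) (hc : 1 ≤ c) :
    ExtHankel.IsDelightful MonomialOrder.degLex (ExtHankel.hankelIdeal K n c 2) ∧
    ∀ r : ℕ, 1 ≤ r →
      ExtHankel.secantIdeal r (ExtHankel.hankelIdeal K n c 2) =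
          ExtHankel.hankelIdeal K n c (r + 1) ∧
        ExtHankel.IsGroebnerBasis MonomialOrder.degLex
          (ExtHankel.minors (r + 1) (ExtHankel.hankelMatrix K n c (r + 1)))
          (ExtHankel.secantIdeal r (ExtHankel.hankelIdeal K n c 2)) := by
  refine ⟨fun r hr => ?_, fun r hr => ?_⟩
  · obtain ⟨r, rfl⟩ := Nat.exists_eq_add_of_le' hr
    rw [ExtHankel.initialIdeal_secantIdeal_hankelIdeal hc,
      ExtHankel.initialIdeal_hankelIdeal_two hc]
    exact le_antisymm (ExtHankel.gapIdeal_le_secantIdeal c (r + 1))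
      (ExtHankel.secantIdeal_gapIdeal_le c r)
  · obtain ⟨r, rfl⟩ := Nat.exists_eq_add_of_le' hr
    refine ⟨ExtHankel.secantIdeal_hankelIdeal hc r, ?_,
      fun h => ExtHankel.ne_zero_of_mem_minors hc h rfl,
      ExtHankel.minors_subset_secantIdeal (r + 1), ?_⟩
    · have : Finite (Fin (r + 1 + 1) ↪o Fin (r + 1 + 1)) := DFunLike.finite _
      have : Finite (Fin (r + 1 + 1) ↪o Fin (n - (r + 1 + 1 - 1) * c)) := DFunLike.finite _
      refine (Set.finite_range fun q : (Fin (r + 1 + 1) ↪o Fin (r + 1 + 1)) ×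
        (Fin (r + 1 + 1) ↪o Fin (n - (r + 1 + 1 - 1) * c)) =>
          ((ExtHankel.hankelMatrix K n c (r + 1 + 1)).submatrix q.1 q.2).det).subset ?_
      rintro _ ⟨f, g, rfl⟩
      exact ⟨(f, g), rfl⟩
    · rw [ExtHankel.image_leadingTerm_minors hc,
        ExtHankel.initialIdeal_secantIdeal_hankelIdeal hc]
      rfl
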